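/- Let $0<a<1$ and let $f:\mathbb R\to\mathbb C$ be a measurable function, with Fourier transform $\widehat f(\xi)=\int_{\mathbb R}e^{-2\pi i x\xi}f(x)\,dx$, such that $$\int_{\mathbb R}|f(x)|^{2}e^{2a\pi x^{2}}\,dx<\infty\qquad\text{and}\qquad \int_{\mathbb R}|\widehat f(\xi)|^{2}e^{2a\pi \xi^{2}}\,d\xi<\infty .$$ (The first condition implies $f\in L^1(\mathbb R)$, so that $\widehat f$ is well defined.) Then for every $\varepsilon>0$, $$f(x)\,e^{(a-\varepsilon)\pi x^{2}}\in L^{\infty}(\mathbb R)\qquad\text{and}\qquad \widehat f(\xi)\,e^{(a-\varepsilon)\pi \xi^{2}}\in L^{\infty}(\mathbb R).$$ -/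

import Mathlib

open MeasureTheory
open scoped FourierTransform ENNReal

/-! Gaussian decay of `f` in mean square makes all moments of `f` finite, so the `n`-th differences
of `𝓕 f` with step `τ` are `O(|τ| ^ n)`. Such a difference expresses `𝓕 f x` through values farther
from the origin, up to that error. Averaging over steps of size at most `δ` replaces those values by
integrals, which the weighted norm of `𝓕 f` bounds by a multiple of `exp (-aπx²)`. Undoing the
average costs `1/δ`; with `δ = exp (-επx²)` this is exactly the lost `ε`, and a large `n` makes the
error negligible. By Fourier inversion `f` is itself a transform, so the same argument bounds it. -/

/-- A function whose product with a Gaussian weight is square integrable has absolute moments of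
every order. -/
theorem integrable_abs_pow_mul_norm_of_memLp_gaussian {a : ℝ} (ha : 0 < a) {h : ℝ → ℂ}
    (hh : MemLp (fun x : ℝ => h x * (Real.exp (a * Real.pi * x ^ 2) : ℂ)) 2 volume) (n : ℕ) :
    Integrable (fun v : ℝ => |v| ^ n * ‖h v‖) := by
  have hsq : Integrable (fun x : ℝ => ‖h x * (Real.exp (a * Real.pi * x ^ 2) : ℂ)‖ ^ 2) :=
    (memLp_two_iff_integrable_sq_norm hh.1).1 hh
  have hG : Integrable (fun x : ℝ => x ^ (2 * n) * Real.exp (-(2 * a * Real.pi) * x ^ 2)) := by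
    have := integrable_rpow_mul_exp_neg_mul_sq (b := 2 * a * Real.pi) (by positivity)
      (s := ((2 * n : ℕ) : ℝ)) (lt_of_lt_of_le (by norm_num) (Nat.cast_nonneg _))
    simpa only [Real.rpow_natCast] using this
  have hmeas : AEStronglyMeasurable (fun v : ℝ => |v| ^ n * ‖h v‖) volume := by
    have h1 : AEStronglyMeasurable (fun v : ℝ => (|v| ^ n * Real.exp (-(a * Real.pi * v ^ 2))) *
        ‖h v * (Real.exp (a * Real.pi * v ^ 2) : ℂ)‖) volume :=
      (Continuous.aestronglyMeasurable (by fun_prop)).mul hh.1.norm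
    refine h1.congr (ae_of_all _ fun v => ?_)
    simp only [norm_mul, Complex.norm_real, Real.norm_eq_abs, Real.abs_exp]
    rw [Real.exp_neg]
    field_simp
  refine (hsq.add hG).mono' hmeas (ae_of_all _ fun v => ?_)
  simp only [Pi.add_apply, norm_mul, Complex.norm_real, Real.norm_eq_abs, Real.abs_exp, norm_pow,
    abs_abs]
  rw [abs_of_nonneg (norm_nonneg (h v))]
  have e1 : Real.exp (-(2 * a * Real.pi) * v ^ 2) = Real.exp (-(a * Real.pi * v ^ 2)) ^ 2 := by
    rw [← Real.exp_nat_mul]; congr 1; push_cast; ring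
  have e2 : v ^ (2 * n) = (|v| ^ n) ^ 2 := by
    rw [← pow_mul, mul_comm n 2, pow_mul, pow_mul, sq_abs]
  have e3 : Real.exp (a * Real.pi * v ^ 2) * Real.exp (-(a * Real.pi * v ^ 2)) = 1 := by
    rw [← Real.exp_add, add_neg_cancel, Real.exp_zero]
  rw [e1, e2]
  set A := |v| ^ n
  set B := ‖h v‖
  set P := Real.exp (a * Real.pi * v ^ 2)
  set Q := Real.exp (-(a * Real.pi * v ^ 2))
  have h0 : 0 ≤ A * B := by positivity
  -- Splitting the weight as `P * Q = 1`, AM-GM bounds the product by the two integrable squares.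
  have h1 : A * B = (B * P) * (A * Q) := by linear_combination (-(A * B)) * e3
  nlinarith [sq_nonneg (B * P - A * Q)]

theorem integrable_of_memLp_gaussian {a : ℝ} (ha : 0 < a) {h : ℝ → ℂ}
    (hh : MemLp (fun x : ℝ => h x * (Real.exp (a * Real.pi * x ^ 2) : ℂ)) 2 volume) :
    Integrable h := by
  have h1 := integrable_abs_pow_mul_norm_of_memLp_gaussian ha hh 0
  have hm : AEStronglyMeasurable h volume := by
    have h2 : AEStronglyMeasurable (fun v : ℝ => h v * (Real.exp (a * Real.pi * v ^ 2) : ℂ) *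
        (Real.exp (-(a * Real.pi * v ^ 2)) : ℂ)) volume :=
      hh.1.mul (Continuous.aestronglyMeasurable (by fun_prop))
    refine h2.congr (ae_of_all _ fun v => ?_)
    simp only [mul_assoc, ← Complex.ofReal_mul, ← Real.exp_add, add_neg_cancel, Real.exp_zero,
      Complex.ofReal_one, mul_one]
  exact (integrable_norm_iff hm).1 (by simpa using h1)

/-- Finite differences of order `n` of a Fourier transform are controlled by the moment of
order `n`. -/
theorem norm_sum_choose_fourier_le {h : ℝ → ℂ} (hi : Integrable h) {n : ℕ}
    (hn : Integrable (fun v : ℝ => |v| ^ n * ‖h v‖)) (x τ : ℝ) :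
    ‖∑ k ∈ Finset.range (n + 1), ((-1) ^ k * (n.choose k : ℂ)) * 𝓕 h (x + k * τ)‖ ≤
      ((2 * Real.pi) ^ n * ∫ v, |v| ^ n * ‖h v‖) * |τ| ^ n := by
  have hF : ∀ y : ℝ, 𝓕 h y = ∫ v, Complex.exp (↑(-2 * Real.pi * v * y) * Complex.I) * h v :=
    fun y => by simp [Real.fourier_real_eq_integral_exp_smul]
  have hint : ∀ y : ℝ,
      Integrable (fun v => Complex.exp (↑(-2 * Real.pi * v * y) * Complex.I) * h v) := fun y =>
    hi.bdd_mul (c := 1) (Continuous.aestronglyMeasurable (by fun_prop))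
      (ae_of_all _ fun v => (Complex.norm_exp_ofReal_mul_I _).le)
  -- By the binomial theorem the difference multiplies the integrand by `(1 - e^{-2πivτ}) ^ n`, of
  -- size at most `(2π|τ||v|) ^ n`.
  have key : ∑ k ∈ Finset.range (n + 1), ((-1) ^ k * (n.choose k : ℂ)) * 𝓕 h (x + k * τ) =
      ∫ v, Complex.exp (↑(-2 * Real.pi * v * x) * Complex.I) *
        (1 - Complex.exp (↑(-2 * Real.pi * v * τ) * Complex.I)) ^ n * h v := by
    simp only [hF, ← integral_const_mul]
    rw [← integral_finsetSum _ fun k _ => (hint _).const_mul _]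
    congr 1
    ext v
    rw [sub_eq_neg_add, add_pow, Finset.mul_sum, Finset.sum_mul]
    refine Finset.sum_congr rfl fun k _ => ?_
    have : Complex.exp (↑(-2 * Real.pi * v * (x + k * τ)) * Complex.I) =
        Complex.exp (↑(-2 * Real.pi * v * x) * Complex.I) *
          Complex.exp (↑(-2 * Real.pi * v * τ) * Complex.I) ^ k := by
      rw [← Complex.exp_nat_mul, ← Complex.exp_add]
      congr 1
      push_cast
      ring
    rw [this, neg_pow (Complex.exp _) k]
    ring
  rw [key, mul_right_comm, ← integral_const_mul]
  refine norm_integral_le_of_norm_le (hn.const_mul _) (ae_of_all _ fun v => ?_)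
  rw [norm_mul, norm_mul, Complex.norm_exp_ofReal_mul_I, one_mul, norm_pow, norm_sub_rev]
  have hb : ‖Complex.exp (↑(-2 * Real.pi * v * τ) * Complex.I) - 1‖ ≤
      2 * Real.pi * |τ| * |v| := by
    have := Real.norm_exp_I_mul_ofReal_sub_one_le (x := -2 * Real.pi * v * τ)
    rw [mul_comm] at this
    refine this.trans (le_of_eq ?_)
    simp only [norm_mul, Real.norm_eq_abs, abs_neg, abs_two, abs_of_pos Real.pi_pos]
    ring
  calc _ ≤ (2 * Real.pi * |τ| * |v|) ^ n * ‖h v‖ := by gcongr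
    _ = _ := by ring

/-- Averaging a continuous function with a square integrable Gaussian weight over a segment
pointing away from the origin. -/
theorem intervalIntegral_norm_comp_affine_le {a : ℝ} (ha : 0 < a) {g : ℝ → ℂ} (hc : Continuous g)
    (hg : MemLp (fun x : ℝ => g x * (Real.exp (a * Real.pi * x ^ 2) : ℂ)) 2 volume)
    {x c δ : ℝ} (hc1 : 1 ≤ |c|) (hcx : 0 ≤ c * x) (hδ : 0 ≤ δ) :
    ∫ t in (0 : ℝ)..δ, ‖g (x + c * t)‖ ≤ Real.exp (-(a * Real.pi * x ^ 2)) *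
      ((∫ y, ‖g y * (Real.exp (a * Real.pi * y ^ 2) : ℂ)‖ ^ 2) + δ) := by
  set W : ℝ → ℝ := fun y => ‖g y * (Real.exp (a * Real.pi * y ^ 2) : ℂ)‖ ^ 2 with hW
  have hWi : Integrable W := (memLp_two_iff_integrable_sq_norm hg.1).1 hg
  have hWc : Continuous W := by fun_prop
  have hc0 : c ≠ 0 := fun h => by norm_num [h] at hc1
  have hWci : Integrable (fun t => W (x + c * t)) :=
    (hWi.comp_add_left x).comp_mul_left' hc0
  have hpt : ∀ t ∈ Set.Icc 0 δ,
      ‖g (x + c * t)‖ ≤ Real.exp (-(a * Real.pi * x ^ 2)) * (W (x + c * t) + 1) := by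
    intro t ht
    have hx2 : x ^ 2 ≤ (x + c * t) ^ 2 := by
      nlinarith [mul_nonneg hcx ht.1, sq_nonneg (c * t)]
    have hE : Real.exp (a * Real.pi * x ^ 2) ≤ Real.exp (a * Real.pi * (x + c * t) ^ 2) := by
      gcongr
    rw [Real.exp_neg, inv_mul_eq_div, le_div_iff₀ (Real.exp_pos _)]
    simp only [hW, norm_mul, Complex.norm_real, Real.norm_eq_abs, Real.abs_exp]
    have := mul_le_mul_of_nonneg_left hE (norm_nonneg (g (x + c * t)))
    -- From `u ≤ u² + 1`, in place of Cauchy–Schwarz.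
    nlinarith [sq_nonneg (‖g (x + c * t)‖ * Real.exp (a * Real.pi * (x + c * t) ^ 2) - 1)]
  have hle : ∫ t in (0 : ℝ)..δ, W (x + c * t) ≤ ∫ y, W y := by
    rw [intervalIntegral.integral_of_le hδ]
    calc _ ≤ ∫ t, W (x + c * t) :=
          setIntegral_le_integral hWci (ae_of_all _ fun t => sq_nonneg _)
      _ = |c⁻¹| * ∫ y, W y := by
          rw [Measure.integral_comp_mul_left (fun s => W (x + s)) c,
            integral_add_left_eq_self W x, smul_eq_mul]
      _ ≤ 1 * ∫ y, W y := by
          refine mul_le_mul_of_nonneg_right ?_ (integral_nonneg fun t => sq_nonneg _)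
          rw [abs_inv]
          exact inv_le_one_of_one_le₀ hc1
      _ = _ := one_mul _
  calc _ ≤ ∫ t in (0 : ℝ)..δ, Real.exp (-(a * Real.pi * x ^ 2)) * (W (x + c * t) + 1) :=
        intervalIntegral.integral_mono_on hδ
          (Continuous.intervalIntegrable (by fun_prop) _ _)
          (Continuous.intervalIntegrable (by fun_prop) _ _) hpt
    _ = Real.exp (-(a * Real.pi * x ^ 2)) * ((∫ t in (0 : ℝ)..δ, W (x + c * t)) + δ) := by
        rw [intervalIntegral.integral_const_mul, intervalIntegral.integral_add
          (Continuous.intervalIntegrable (by fun_prop) _ _)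
          (Continuous.intervalIntegrable (by fun_prop) _ _)]
        simp
    _ ≤ _ := by gcongr

/-- If `h` has moments of all orders and its Fourier transform is square integrable against a
Gaussian weight, then the Fourier transform satisfies pointwise Gaussian bounds with any smaller
rate. -/
theorem exists_norm_fourier_mul_gaussian_le {a : ℝ} (ha : 0 < a) {h : ℝ → ℂ} (hi : Integrable h)
    (hmom : ∀ n : ℕ, Integrable (fun v : ℝ => |v| ^ n * ‖h v‖))
    (hg : MemLp (fun x : ℝ => 𝓕 h x * (Real.exp (a * Real.pi * x ^ 2) : ℂ)) 2 volume)
    {ε : ℝ} (hε : 0 < ε) :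
    ∃ C : ℝ, ∀ x : ℝ, ‖𝓕 h x * (Real.exp ((a - ε) * Real.pi * x ^ 2) : ℂ)‖ ≤ C := by
  have hc : Continuous (𝓕 h) :=
    VectorFourier.fourierIntegral_continuous Real.continuous_fourierChar
      (by fun_prop) hi
  -- `n * ε ≥ a - ε` is what `E * δ ^ n ≤ 1` needs below.
  obtain ⟨n, hn⟩ := exists_nat_ge ((a - ε) / ε)
  rw [div_le_iff₀ hε] at hn
  set K : ℝ := (2 * Real.pi) ^ n * ∫ v, |v| ^ n * ‖h v‖ with hK
  have hK0 : 0 ≤ K := mul_nonneg (by positivity) (integral_nonneg fun v => by positivity)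
  set M : ℝ := ∫ y, ‖𝓕 h y * (Real.exp (a * Real.pi * y ^ 2) : ℂ)‖ ^ 2 with hM
  have hM0 : 0 ≤ M := integral_nonneg fun v => by positivity
  set S : ℝ := ∑ k ∈ Finset.range n, (n.choose (k + 1) : ℝ) with hS
  have hS0 : 0 ≤ S := Finset.sum_nonneg fun k _ => by positivity
  refine ⟨S * (M + 1) + K, fun x => ?_⟩
  -- Steps in the direction `σ` move away from the origin, where the weight only grows.
  obtain ⟨σ, hσ1, hσx⟩ : ∃ σ : ℝ, |σ| = 1 ∧ 0 ≤ σ * x := by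
    rcases le_total 0 x with hx | hx
    · exact ⟨1, by simp, by simpa using hx⟩
    · exact ⟨-1, by simp, by simpa using hx⟩
  set δ : ℝ := Real.exp (-(ε * Real.pi * x ^ 2)) with hδ
  have hδ0 : 0 < δ := Real.exp_pos _
  have hδ1 : δ ≤ 1 := Real.exp_le_one_iff.2 (by rw [neg_nonpos]; positivity)
  have hpt : ∀ t ∈ Set.Icc 0 δ, ‖𝓕 h x‖ ≤
      (∑ k ∈ Finset.range n, (n.choose (k + 1) : ℝ) * ‖𝓕 h (x + ((k + 1 : ℕ) * σ) * t)‖)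
        + K * δ ^ n := by
    intro t ht
    have h1 := norm_sum_choose_fourier_le hi (hmom n) x (σ * t)
    rw [Finset.sum_range_succ'] at h1
    simp only [pow_zero, Nat.choose_zero_right, Nat.cast_one, Nat.cast_zero, zero_mul, add_zero,
      one_mul] at h1
    rw [← hK, abs_mul, hσ1, one_mul, abs_of_nonneg ht.1] at h1
    have h2 : K * t ^ n ≤ K * δ ^ n := by
      have := ht.1
      have := ht.2
      gcongr
    have h3 := norm_sum_le (Finset.range n) (fun k =>
      ((-1) ^ (k + 1) * (n.choose (k + 1) : ℂ)) * 𝓕 h (x + (k + 1 : ℕ) * (σ * t)))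
    simp only [norm_mul, norm_pow, norm_neg, norm_one, one_pow, one_mul,
      Complex.norm_natCast, ← mul_assoc] at h3
    simp only [← mul_assoc] at h1
    have h4 := norm_sub_le_norm_add (𝓕 h x) (∑ k ∈ Finset.range n,
      ((-1) ^ (k + 1) * (n.choose (k + 1) : ℂ)) * 𝓕 h (x + (k + 1 : ℕ) * σ * t))
    rw [add_comm (𝓕 h x)] at h4
    linarith
  have hint := intervalIntegral.integral_mono_on hδ0.le
    (Continuous.intervalIntegrable (by fun_prop) (μ := volume) _ _)
    (Continuous.intervalIntegrable (by fun_prop) _ _) hpt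
  rw [intervalIntegral.integral_const, intervalIntegral.integral_add
    (Continuous.intervalIntegrable (by fun_prop) _ _)
    (Continuous.intervalIntegrable (by fun_prop) _ _), intervalIntegral.integral_finsetSum
    (fun k _ => Continuous.intervalIntegrable (by fun_prop) _ _)] at hint
  simp only [intervalIntegral.integral_const_mul, intervalIntegral.integral_const, sub_zero,
    smul_eq_mul] at hint
  have hsum : ∑ k ∈ Finset.range n, (n.choose (k + 1) : ℝ) *
      ∫ t in (0 : ℝ)..δ, ‖𝓕 h (x + ((k + 1 : ℕ) * σ) * t)‖ ≤
        S * (Real.exp (-(a * Real.pi * x ^ 2)) * (M + 1)) := by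
    rw [hS, Finset.sum_mul]
    refine Finset.sum_le_sum fun k _ => ?_
    gcongr
    refine (intervalIntegral_norm_comp_affine_le ha hc hg ?_ ?_ hδ0.le).trans (by gcongr)
    · rw [abs_mul, hσ1, mul_one, Nat.abs_cast]
      exact_mod_cast Nat.le_add_left 1 k
    · rw [mul_assoc]; positivity
  rw [norm_mul, Complex.norm_real, Real.norm_eq_abs, Real.abs_exp]
  set E := Real.exp ((a - ε) * Real.pi * x ^ 2) with hE
  have hE1 : E * Real.exp (-(a * Real.pi * x ^ 2)) = δ := by
    rw [hE, hδ, ← Real.exp_add]; congr 1; ring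
  have hE2 : E * δ ^ n ≤ 1 := by
    rw [hE, hδ, ← Real.exp_nat_mul, ← Real.exp_add, Real.exp_le_one_iff]
    have : 0 ≤ Real.pi * x ^ 2 := by positivity
    nlinarith
  have hE0 : 0 < E := Real.exp_pos _
  have hfin : δ * (‖𝓕 h x‖ * E) ≤ δ * (S * (M + 1) + K) := by
    calc δ * (‖𝓕 h x‖ * E) = E * (δ * ‖𝓕 h x‖) := by ring
      _ ≤ E * (S * (Real.exp (-(a * Real.pi * x ^ 2)) * (M + 1)) + δ * (K * δ ^ n)) := by
          gcongr
          linarith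
      _ = S * (M + 1) * (E * Real.exp (-(a * Real.pi * x ^ 2))) + δ * K * (E * δ ^ n) := by ring
      _ ≤ S * (M + 1) * δ + δ * K * 1 := by rw [hE1]; gcongr
      _ = _ := by ring
  exact le_of_mul_le_mul_left hfin hδ0

/-- Fourier inversion almost everywhere, for integrable functions with integrable Fourier
transform. -/
theorem fourierInv_fourier_ae_eq {f : ℝ → ℂ} (hf : Integrable f) (hf' : Integrable (𝓕 f)) :
    𝓕⁻ (𝓕 f) =ᵐ[volume] f := by
  have hFF : 𝓕⁻ (𝓕 f) = 𝓕 (fun ξ => 𝓕 f (-ξ)) := Real.fourierInv_eq_fourier_comp_neg _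
  have hc : Continuous (𝓕⁻ (𝓕 f)) := by
    rw [hFF]
    exact VectorFourier.fourierIntegral_continuous Real.continuous_fourierChar
      (by fun_prop) hf'.comp_neg
  -- Testing against smooth `φ` moves both transforms onto `φ`, where Schwartz inversion applies.
  refine ae_eq_of_integral_contDiff_smul_eq hc.locallyIntegrable hf.locallyIntegrable
    fun φ hφ hφc => ?_
  have hs : HasCompactSupport (fun x => (φ x : ℂ)) := hφc.comp_left (g := ((↑) : ℝ → ℂ)) rfl
  let ψ : SchwartzMap ℝ ℂ := hs.toSchwartzMap (Complex.ofRealCLM.contDiff.comp hφ)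
  have hψ : ∀ x, ψ x = (φ x : ℂ) := fun x => rfl
  have flip : ∀ (u v : ℝ → ℂ), Integrable u → Integrable v →
      ∫ ξ, 𝓕 u ξ * v ξ = ∫ x, u x * 𝓕 v x := fun u v hu hv => by
    simpa using! VectorFourier.integral_fourierIntegral_smul_eq_flip (L := innerₗ ℝ)
      (μ := volume) (ν := volume) Real.continuous_fourierChar continuous_inner hu hv
  have e2 : 𝓕 (𝓕⁻ (ψ : ℝ → ℂ)) = ψ := by
    rw [← SchwartzMap.fourierInv_coe, ← SchwartzMap.fourier_coe, FourierTransform.fourier_fourierInv_eq]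
  have hψi : Integrable (𝓕⁻ (ψ : ℝ → ℂ)) := by
    rw [← SchwartzMap.fourierInv_coe]; exact SchwartzMap.integrable _
  calc ∫ x, φ x • 𝓕⁻ (𝓕 f) x = ∫ x, 𝓕 (fun ξ => 𝓕 f (-ξ)) x * ψ x := by
        simp only [hFF, hψ, Complex.real_smul, mul_comm]
    _ = ∫ ξ, 𝓕 f (-ξ) * 𝓕 (ψ : ℝ → ℂ) ξ := flip _ _ hf'.comp_neg ψ.integrable
    _ = ∫ ξ, 𝓕 f ξ * 𝓕⁻ (ψ : ℝ → ℂ) ξ := by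
        rw [← integral_neg_eq_self]
        simp only [neg_neg, Real.fourierInv_eq_fourier_neg]
    _ = ∫ x, f x * ψ x := by rw [flip _ _ hf hψi, e2]
    _ = ∫ x, φ x • f x := by simp only [hψ, Complex.real_smul, mul_comm]

theorem theorem1 (a : ℝ) (ha0 : 0 < a) (ha1 : a < 1) (f : ℝ → ℂ)
    (hf : MemLp (fun x : ℝ => f x * (Real.exp (a * Real.pi * x ^ 2) : ℂ)) 2 volume)
    (hfhat : MemLp (fun ξ : ℝ => (𝓕 f) ξ * (Real.exp (a * Real.pi * ξ ^ 2) : ℂ)) 2 volume) :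
    ∀ ε : ℝ, 0 < ε →
      MemLp (fun x : ℝ => f x * (Real.exp ((a - ε) * Real.pi * x ^ 2) : ℂ)) ∞ volume ∧
      MemLp (fun ξ : ℝ => (𝓕 f) ξ * (Real.exp ((a - ε) * Real.pi * ξ ^ 2) : ℂ)) ∞ volume := by
  intro ε hε
  have hfi := integrable_of_memLp_gaussian ha0 hf
  have hFi := integrable_of_memLp_gaussian ha0 hfhat
  have hinv : 𝓕 (fun ξ => 𝓕 f (-ξ)) =ᵐ[volume] f := by
    rw [← Real.fourierInv_eq_fourier_comp_neg]
    exact fourierInv_fourier_ae_eq hfi hFi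
  constructor
  · have hg : MemLp (fun x : ℝ => 𝓕 (fun ξ => 𝓕 f (-ξ)) x *
        (Real.exp (a * Real.pi * x ^ 2) : ℂ)) 2 volume := by
      refine (memLp_congr_ae ?_).2 hf
      filter_upwards [hinv] with x hx
      rw [hx]
    obtain ⟨C, hC⟩ := exists_norm_fourier_mul_gaussian_le ha0 hFi.comp_neg (fun n => by
      simpa using (integrable_abs_pow_mul_norm_of_memLp_gaussian ha0 hfhat n).comp_neg) hg hε
    refine memLp_top_of_bound
      (hfi.1.mul (Continuous.aestronglyMeasurable (by fun_prop))) C ?_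
    filter_upwards [hinv] with x hx
    rw [← hx]
    exact hC x
  · obtain ⟨C, hC⟩ := exists_norm_fourier_mul_gaussian_le ha0 hfi
      (integrable_abs_pow_mul_norm_of_memLp_gaussian ha0 hf) hfhat hε
    exact memLp_top_of_bound
      (hFi.1.mul (Continuous.aestronglyMeasurable (by fun_prop))) C (ae_of_all _ hC)
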